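/- **Theorem 5 (Bernstein inequality).** Let $c\in\mathbb R$ and $T>0$. Let $X^2_c$ be the space of all $f:\mathbb R^+\to\mathbb C$ such that $u\mapsto f(u)u^{c-1/2}$ belongs to $L^2(\mathbb R^+)$, with norm $\|f\|_{X^2_c}=\left(\int_0^\infty |u^cf(u)|^2\,\frac{du}{u}\right)^{1/2}$. Let $\Omega=\mathbb C\setminus[0,\infty)$, and let $\widetilde B^2_{c,T}$ be the Mellin–Bernstein space of all $f\in X^2_c$ for which $g(x):=x^cf(x)$, $x>0$, has an analytic extension to the Riemann surface of the logarithm, that is, for which there are analytic functions $g_k:\Omega\to\mathbb C$, $k\in\mathbb Z$, such that: (i) for all $x>0$ and $k\in\mathbb Z$ the limits $g_k^\pm(x)=\lim_{\varepsilon\to0+}g_k(x\pm i\varepsilon)$ exist, $g_k^-(x)=g_{k+1}^+(x)$, and $g_0^+(x)=g(x)$; (ii) for every $x>0$, every open disk $U_x$ in the right half-plane with center $x$, and every $k\in\mathbb Z$, the function on $U_x$ that equals $g_k$ where $\Im z<0$, $g_k^-$ on $U_x\cap\mathbb R$, and $g_{k+1}$ where $\Im z>0$ is analytic; (iii) there is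 a constant $C>0$ with $|g_k(re^{i\theta})|\le Ce^{T|2\pi k+\theta|}$ for all $k\in\mathbb Z$, $\theta\in[0,2\pi]$, $r>0$; (iv) for every $k\in\mathbb Z$, $\lim_{r\to0+}g_k(re^{i\theta})=\lim_{r\to\infty}g_k(re^{i\theta})=0$ uniformly in $\theta\in[0,2\pi]$; where in (iii) and (iv) $g_k(re^{i\theta})$ means $g_k^+(r)$ for $\theta=0$ and $g_k^-(r)$ for $\theta=2\pi$. Let $\Theta_cf(x)=xf'(x)+cf(x)$ be the Mellin derivative, $\Theta_c^0f=f$, and $\Theta_c^r=\Theta_c(\Theta_c^{r-1})$ for $r\ge1$. Then every $f\in\widetilde B^2_{c,T}$ is infinitely differentiable on $\mathbb R^+$, and for every integer $r\ge0$ one has $\Theta_c^rf\in X^2_c$ and $$\|\Theta_c^rf\|_{X^2_c}\le T^r\,\|f\|_{X^2_c}.$$ The inequality is sharp: for every $r$, if $K\in\mathbb R$ is such that $\|\Theta_c^rf\|_{X^2_c}\le K\|f\|_{X^2_c}$ for all $f\in\widetilde B^2_{c,T}$, then $K\ge T^r$. -/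

import Mathlib

open Set Filter Topology MeasureTheory

noncomputable section

/-- The weighted function `u ↦ u ^ (c - 1/2) * f u`. Functions on `ℝ⁺` are modelled by functions
`ℝ → ℂ` of which only the values on `(0, ∞)` are ever used. -/
def mellinWeighted (c : ℝ) (f : ℝ → ℂ) (u : ℝ) : ℂ :=
  ((u ^ (c - 1 / 2) : ℝ) : ℂ) * f u

/-- Membership in the space `X²_c`: the function `u ^ (c - 1/2) * f u` is in `L²(0, ∞)`. -/
def MemMellinX2 (c : ℝ) (f : ℝ → ℂ) : Prop :=
  MemLp (mellinWeighted c f) 2 (volume.restrict (Ioi (0 : ℝ)))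

/-- The norm of `X²_c`, the `L²(0, ∞)`-norm of `u ^ (c - 1/2) * f u`. -/
def mellinX2Norm (c : ℝ) (f : ℝ → ℂ) : ℝ :=
  (eLpNorm (mellinWeighted c f) 2 (volume.restrict (Ioi (0 : ℝ)))).toReal

/-- The Mellin derivative `Θ_c f (x) = x f'(x) + c f(x)`. -/
def mellinDeriv (c : ℝ) (f : ℝ → ℂ) (x : ℝ) : ℂ :=
  (x : ℂ) * deriv f x + (c : ℂ) * f x

/-- The Mellin derivative of order `r`: `Θ_c^0 = I` and `Θ_c^r = Θ_c (Θ_c^(r-1))`. -/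
def mellinDerivIter (c : ℝ) : ℕ → (ℝ → ℂ) → (ℝ → ℂ)
  | 0, f => f
  | r + 1, f => mellinDeriv c (mellinDerivIter c r f)

/-- The slit plane `Ω`, the complement in `ℂ` of the closed half-line `[0, ∞)`. -/
def slitOmega : Set ℂ :=
  {z : ℂ | ¬ (0 ≤ z.re ∧ z.im = 0)}

/-- The function that equals the branch `gk` below the real axis, its lower boundary
function `gkm` on the real axis and the next branch `gk1` above the real axis. -/
def glueBranches (gk gk1 : ℂ → ℂ) (gkm : ℝ → ℂ) (z : ℂ) : ℂ :=
  if z.im < 0 then gk z else if z.im = 0 then gkm z.re else gk1 z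

/-- The value of a branch at `r * exp (i θ)`, `θ ∈ [0, 2π]`, which is the upper boundary value
`gkp r` for `θ = 0` and the lower boundary value `gkm r` for `θ = 2π`. -/
def polarValue (gk : ℂ → ℂ) (gkp gkm : ℝ → ℂ) (r θ : ℝ) : ℂ :=
  if θ = 0 then gkp r
  else if θ = 2 * Real.pi then gkm r
  else gk ((r : ℂ) * Complex.exp ((θ : ℂ) * Complex.I))

/-- `g k`, `k ∈ ℤ`, are the branches on `Ω` of an analytic function on the Riemann surface of the
logarithm (the sheets being glued crosswise along the positive half-line), with upper and lower
boundary functions `gp k` and `gm k` on the positive half-line. The function on the surface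
extends the function `x ↦ g₀ x` given on the positive half-line of sheet `0`. -/
structure IsLogSurfaceExtension (g₀ : ℝ → ℂ) (g : ℤ → ℂ → ℂ) (gp gm : ℤ → ℝ → ℂ) : Prop where
  analytic_branch : ∀ k : ℤ, AnalyticOnNhd ℂ (g k) slitOmega
  tendsto_upper : ∀ k : ℤ, ∀ x : ℝ, 0 < x →
    Tendsto (fun ε : ℝ => g k ((x : ℂ) + (ε : ℂ) * Complex.I)) (𝓝[>] 0) (𝓝 (gp k x))
  tendsto_lower : ∀ k : ℤ, ∀ x : ℝ, 0 < x →
    Tendsto (fun ε : ℝ => g k ((x : ℂ) - (ε : ℂ) * Complex.I)) (𝓝[>] 0) (𝓝 (gm k x))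
  lower_eq_upper_succ : ∀ k : ℤ, ∀ x : ℝ, 0 < x → gm k x = gp (k + 1) x
  upper_zero_eq : ∀ x : ℝ, 0 < x → gp 0 x = g₀ x
  analytic_glue : ∀ k : ℤ, ∀ x ρ : ℝ, 0 < x → 0 < ρ →
    Metric.ball (x : ℂ) ρ ⊆ {z : ℂ | 0 < z.re} →
    AnalyticOnNhd ℂ (glueBranches (g k) (g (k + 1)) (gm k)) (Metric.ball (x : ℂ) ρ)

/-- Membership in the Mellin-Bernstein space of parameters `c` and `T`: `f ∈ X²_c`, and
`x ^ c * f x` has an analytic extension to the Riemann surface of the logarithm whose branches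
satisfy the exponential bound and vanish at `0` and at `∞`, uniformly in the angle. -/
def MemMellinBernstein (c T : ℝ) (f : ℝ → ℂ) : Prop :=
  MemMellinX2 c f ∧
  ∃ (g : ℤ → ℂ → ℂ) (gp gm : ℤ → ℝ → ℂ),
    IsLogSurfaceExtension (fun x : ℝ => ((x ^ c : ℝ) : ℂ) * f x) g gp gm ∧
    (∃ C : ℝ, 0 < C ∧ ∀ k : ℤ, ∀ θ ∈ Icc (0 : ℝ) (2 * Real.pi), ∀ r : ℝ, 0 < r →
      ‖polarValue (g k) (gp k) (gm k) r θ‖ ≤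
        C * Real.exp (T * |2 * Real.pi * (k : ℝ) + θ|)) ∧
    (∀ k : ℤ,
      TendstoUniformlyOn (fun r θ : ℝ => polarValue (g k) (gp k) (gm k) r θ) (fun _ => 0)
        (𝓝[>] 0) (Icc (0 : ℝ) (2 * Real.pi)) ∧
      TendstoUniformlyOn (fun r θ : ℝ => polarValue (g k) (gp k) (gm k) r θ) (fun _ => 0)
        atTop (Icc (0 : ℝ) (2 * Real.pi)))

end

/-!
In the coordinate `w = log z` the logarithmic surface becomes the plane, and `x ^ c * f x` becomes
the restriction to `ℝ` of an entire function `G` with `‖G w‖ ≤ C exp (T |Im w|)`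
(`MemMellinBernstein.exists_isBernsteinEntire`). The norm of `X²_c` becomes the norm of `L²(ℝ)`, and
the Mellin derivative becomes `G'`. The inequality is therefore Bernstein's inequality in `L²(ℝ)`
for entire functions of exponential type.

That inequality (`IsBernsteinEntire.lineEnergy_deriv_le`) is proved without Fourier analysis.
By Phragmén–Lindelöf and Cauchy's estimate on circles of radius `n / T`, applied to the functions
`z ↦ ∫ G (t + z) φ t`, the `L²`-norm of `G⁽ⁿ⁾` is at most `n! (e / n) ^ n T ^ n` times that of `G`,
and by Stirling's formula the factor `n! (e / n) ^ n` grows only polynomially. Integration by parts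
shows that the norms of `G, G', G'', …` form a log-convex sequence, so `(‖G'‖ / ‖G‖) ^ n` is at most
`‖G⁽ⁿ⁾‖ / ‖G‖`; taking `n`-th roots removes the polynomial factor and leaves `‖G'‖ ≤ T ‖G‖`.

For sharpness, `G z = exp (i (T - b) z) sinc (b z)` lies in the class
(`memMellinBernstein_mellinPullback`, `exists_extremal`). Bernstein's inequality for `sinc (b z)`
shows that differentiating `G` is multiplication by `i (T - b)` up to an error of relative size
`b`, so `‖G⁽ʳ⁾‖ / ‖G‖` tends to `T ^ r` as `b → 0`.
-/

noncomputable section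

/-! ### The Bernstein class -/

/-- The Bernstein class of the real line: entire functions `G` with `‖G z‖ ≤ C exp (T |Im z|)` on all
of `ℂ` whose restriction to `ℝ` is square integrable. -/
structure IsBernsteinEntire (T : ℝ) (G : ℂ → ℂ) : Prop where
  differentiable : Differentiable ℂ G
  growth : ∃ C : ℝ, ∀ z : ℂ, ‖G z‖ ≤ C * Real.exp (T * |z.im|)
  memLp : MemLp (fun x : ℝ => G x) 2

/-- The squared `L²`-norm of the restriction of `G` to the real line. It is a Bochner integral, hence
`0` when that restriction is not square integrable; it is evaluated only where it is. -/
def lineEnergy (G : ℂ → ℂ) : ℝ := ∫ x : ℝ, ‖G x‖ ^ 2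

/-! ### Growth of entire functions bounded on the real line -/

theorem Differentiable.continuous_ofReal_comp {G : ℂ → ℂ} (hG : Differentiable ℂ G) :
    Continuous (fun x : ℝ => G x) :=
  hG.continuous.comp Complex.continuous_ofReal

theorem Differentiable.complex_deriv {G : ℂ → ℂ} (hG : Differentiable ℂ G) :
    Differentiable ℂ (_root_.deriv G) :=
  (hG.contDiff (n := 2)).differentiable_deriv_two

theorem Differentiable.complex_iteratedDeriv {G : ℂ → ℂ} (hG : Differentiable ℂ G) (n : ℕ) :
    Differentiable ℂ (iteratedDeriv n G) :=
  (hG.contDiff (n := ⊤)).differentiable_iteratedDeriv n (by simp)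

/-- Phragmén–Lindelöf in the upper half-plane, applied to the bounded function `G z * exp (i T z)`:
only the bound `M` on the real line matters, the constant `C` of the growth hypothesis
disappears. -/
theorem norm_le_mul_exp_abs_im_of_upper {G : ℂ → ℂ} {T C M : ℝ} (hG : Differentiable ℂ G)
    (hC : ∀ z : ℂ, ‖G z‖ ≤ C * Real.exp (T * |z.im|)) (hM : ∀ x : ℝ, ‖G x‖ ≤ M) {z : ℂ}
    (hz : 0 ≤ z.im) : ‖G z‖ ≤ M * Real.exp (T * |z.im|) := by
  -- Rotate the upper half-plane to the right half-plane, where Mathlib states the principle.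
  set f : ℂ → ℂ := fun w => G (Complex.I * w) * Complex.exp (-(T * w)) with hf
  have hfn (w : ℂ) : ‖f w‖ = ‖G (Complex.I * w)‖ * Real.exp (-(T * w.re)) := by
    simp [hf, Complex.norm_exp]
  have hbd (w : ℂ) (hw : 0 ≤ w.re) : ‖f w‖ ≤ C := by
    rw [hfn]
    have h := hC (Complex.I * w)
    have h1 : (Complex.I * w).im = w.re := by simp
    rw [h1, abs_of_nonneg hw] at h
    calc _ ≤ C * Real.exp (T * w.re) * Real.exp (-(T * w.re)) := by gcongr
      _ = C := by rw [mul_assoc, ← Real.exp_add]; simp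
  have key : ‖f (-Complex.I * z)‖ ≤ M := by
    apply PhragmenLindelof.right_half_plane_of_bounded_on_real
    · apply Differentiable.diffContOnCl
      fun_prop
    · refine ⟨0, by norm_num, 0, ?_⟩
      refine Asymptotics.IsBigO.of_bound C ?_
      filter_upwards [mem_inf_of_right (mem_principal_self _)] with w hw
      simpa using hbd w (le_of_lt hw)
    · refine isBoundedUnder_of_eventually_le (a := C) ?_
      filter_upwards [eventually_ge_atTop 0] with x hx
      exact hbd _ (by simpa using hx)
    · intro x
      rw [hfn]
      have : Complex.I * (x * Complex.I) = ((-x : ℝ) : ℂ) := by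
        push_cast; linear_combination (x : ℂ) * Complex.I_mul_I
      rw [this]
      simpa using hM (-x)
    · simpa using hz
  rw [hfn] at key
  have h1 : Complex.I * (-Complex.I * z) = z := by linear_combination -z * Complex.I_mul_I
  rw [h1, show (-Complex.I * z).re = z.im by simp] at key
  rw [abs_of_nonneg hz]
  calc ‖G z‖ = ‖G z‖ * Real.exp (-(T * z.im)) * Real.exp (T * z.im) := by
        rw [mul_assoc, ← Real.exp_add]; simp
    _ ≤ _ := by gcongr

theorem norm_le_mul_exp_abs_im {G : ℂ → ℂ} {T C M : ℝ} (hG : Differentiable ℂ G)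
    (hC : ∀ z : ℂ, ‖G z‖ ≤ C * Real.exp (T * |z.im|)) (hM : ∀ x : ℝ, ‖G x‖ ≤ M) (z : ℂ) :
    ‖G z‖ ≤ M * Real.exp (T * |z.im|) := by
  rcases le_total 0 z.im with hz | hz
  · exact norm_le_mul_exp_abs_im_of_upper hG hC hM hz
  · have := norm_le_mul_exp_abs_im_of_upper (G := fun w => G (-w)) (T := T) (C := C) (M := M)
      (by fun_prop) (fun w => by simpa using hC (-w)) (fun x => by simpa using hM (-x))
      (z := -z) (by simpa using hz)
    simpa using this

/-- Cauchy estimate on a circle of free radius `ρ`. With `ρ = n / T` the bound is `T ^ n * M` up to a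
factor that grows more slowly than exponentially in `n`. -/
theorem norm_iteratedDeriv_zero_le {G : ℂ → ℂ} {T C M ρ : ℝ} (hT : 0 ≤ T) (hρ : 0 < ρ)
    (hG : Differentiable ℂ G)
    (hC : ∀ z : ℂ, ‖G z‖ ≤ C * Real.exp (T * |z.im|)) (hM : ∀ x : ℝ, ‖G x‖ ≤ M) (n : ℕ) :
    ‖iteratedDeriv n G 0‖ ≤ n.factorial * (M * Real.exp (T * ρ)) / ρ ^ n := by
  refine Complex.norm_iteratedDeriv_le_of_forall_mem_sphere_norm_le n hρ hG.diffContOnCl ?_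
  intro z hz
  have h0 : 0 ≤ M := (norm_nonneg _).trans (hM 0)
  have h1 : |z.im| ≤ ρ := (Complex.abs_im_le_norm z).trans (by simpa using hz.le)
  refine (norm_le_mul_exp_abs_im hG hC hM z).trans ?_
  gcongr

theorem norm_deriv_le_mul_exp_abs_im {G : ℂ → ℂ} {T C : ℝ} (hT : 0 ≤ T) (hG : Differentiable ℂ G)
    (hC : ∀ z : ℂ, ‖G z‖ ≤ C * Real.exp (T * |z.im|)) (z : ℂ) :
    ‖deriv G z‖ ≤ C * Real.exp T * Real.exp (T * |z.im|) := by
  have h0 : 0 ≤ C := by simpa using (norm_nonneg _).trans (hC 0)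
  have := Complex.norm_deriv_le_of_forall_mem_sphere_norm_le (f := G) (c := z) (R := 1)
    (C := C * Real.exp T * Real.exp (T * |z.im|)) one_pos hG.diffContOnCl ?_
  · simpa using this
  intro w hw
  refine (hC w).trans ?_
  rw [mul_assoc, ← Real.exp_add]
  have h1 : |w.im - z.im| ≤ 1 := by
    have := Complex.abs_im_le_norm (w - z)
    rw [mem_sphere_iff_norm] at hw
    simpa [hw] using this
  have h2 : |w.im| ≤ 1 + |z.im| := by
    have := abs_add_le (w.im - z.im) z.im
    simp only [sub_add_cancel] at this
    linarith
  gcongr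
  nlinarith

/-! ### Square integrals of derivatives -/

theorem hasDerivAt_intervalIntegral_translate {G : ℂ → ℂ} (hG : Differentiable ℂ G) {φ : ℝ → ℂ}
    (hφ : Continuous φ) (a b : ℝ) (z : ℂ) :
    HasDerivAt (fun w : ℂ => ∫ t in a..b, G (t + w) * φ t)
      (∫ t in a..b, deriv G (t + z) * φ t) z := by
  have hG' := hG.complex_deriv.continuous
  have hG0 := hG.continuous
  obtain ⟨B, hB⟩ := ((isCompact_uIcc (a := a) (b := b)).prod
    (isCompact_closedBall z 1)).exists_bound_of_continuousOn
    (f := fun p : ℝ × ℂ => deriv G (p.1 + p.2) * φ p.1) (by fun_prop)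
  refine (intervalIntegral.hasDerivAt_integral_of_dominated_loc_of_deriv_le
    (F := fun w t => G (t + w) * φ t) (F' := fun w t => deriv G (t + w) * φ t) (bound := fun _ => B)
    (Metric.closedBall_mem_nhds z one_pos) ?_ ?_ ?_ ?_ ?_ ?_).2
  · exact Eventually.of_forall fun w =>
      (by fun_prop : Continuous fun t : ℝ => G (t + w) * φ t).aestronglyMeasurable
  · exact Continuous.intervalIntegrable (by fun_prop) _ _
  · exact (by fun_prop : Continuous fun t : ℝ => deriv G (t + z) * φ t).aestronglyMeasurable
  · exact Eventually.of_forall fun t ht w hw => hB (t, w) ⟨uIoc_subset_uIcc ht, hw⟩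
  · exact intervalIntegrable_const
  · refine Eventually.of_forall fun t _ w _ => ?_
    exact ((hG _).hasDerivAt.comp_const_add _ _).mul_const _

theorem iteratedDeriv_intervalIntegral_translate {φ : ℝ → ℂ} (hφ : Continuous φ) (a b : ℝ)
    (n : ℕ) {G : ℂ → ℂ} (hG : Differentiable ℂ G) :
    iteratedDeriv n (fun w : ℂ => ∫ t in a..b, G (t + w) * φ t) =
      fun w => ∫ t in a..b, iteratedDeriv n G (t + w) * φ t := by
  induction n generalizing G with
  | zero => simp
  | succ n ih =>
    rw [iteratedDeriv_succ', iteratedDeriv_succ', ← ih hG.complex_deriv]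
    congr 1
    ext w
    exact (hasDerivAt_intervalIntegral_translate hG hφ a b w).deriv

theorem IsBernsteinEntire.integrable_sq {T : ℝ} {G : ℂ → ℂ} (hG : IsBernsteinEntire T G) :
    Integrable (fun x : ℝ => ‖G x‖ ^ 2) :=
  (memLp_two_iff_integrable_sq_norm hG.memLp.1).1 hG.memLp

theorem lineEnergy_nonneg (G : ℂ → ℂ) : 0 ≤ lineEnergy G :=
  integral_nonneg fun _ => by positivity

/-- A Cauchy–Schwarz bound for the integral of a real translate of `G` against `φ`, in the additive
form with a free weight `s`, which avoids square roots. -/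
theorem IsBernsteinEntire.norm_intervalIntegral_translate_le {T : ℝ} {G : ℂ → ℂ}
    (hG : IsBernsteinEntire T G) {φ : ℝ → ℂ} (hφ : Continuous φ) {a b s : ℝ} (hab : a ≤ b)
    (hs : 0 < s) (x : ℝ) :
    ‖∫ t in a..b, G (t + x) * φ t‖ ≤ (s * lineEnergy G + (∫ t in a..b, ‖φ t‖ ^ 2) / s) / 2 := by
  have hc := hG.differentiable.continuous
  have h1 : ∫ t in a..b, ‖G (t + x)‖ ^ 2 ≤ lineEnergy G := by
    have hi : Integrable (fun t : ℝ => ‖G (t + x)‖ ^ 2) := by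
      simpa using hG.integrable_sq.comp_add_right x
    have he : ∫ t : ℝ, ‖G (t + x)‖ ^ 2 = lineEnergy G := by
      simpa [lineEnergy] using integral_add_right_eq_self (μ := volume)
        (fun t : ℝ => ‖G t‖ ^ 2) x
    rw [intervalIntegral.integral_of_le hab, ← he]
    exact setIntegral_le_integral hi (Eventually.of_forall fun _ => by positivity)
  calc ‖∫ t in a..b, G (t + x) * φ t‖
      ≤ ∫ t in a..b, (s / 2 * ‖G (t + x)‖ ^ 2 + 1 / (2 * s) * ‖φ t‖ ^ 2) := by
        refine intervalIntegral.norm_integral_le_of_norm_le hab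
          (Eventually.of_forall fun t _ => ?_) (Continuous.intervalIntegrable (by fun_prop) _ _)
        rw [norm_mul]
        -- Young: `p * q ≤ s / 2 * p ^ 2 + q ^ 2 / (2 * s)`.
        have : 0 ≤ (s * ‖G (t + x)‖ - ‖φ t‖) ^ 2 / (2 * s) := by positivity
        have e : s / 2 * ‖G (t + x)‖ ^ 2 + 1 / (2 * s) * ‖φ t‖ ^ 2 - ‖G (t + x)‖ * ‖φ t‖ =
          (s * ‖G (t + x)‖ - ‖φ t‖) ^ 2 / (2 * s) := by field_simp; ring
        linarith
    _ = s / 2 * (∫ t in a..b, ‖G (t + x)‖ ^ 2) + 1 / (2 * s) * ∫ t in a..b, ‖φ t‖ ^ 2 := by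
        rw [intervalIntegral.integral_add, intervalIntegral.integral_const_mul,
          intervalIntegral.integral_const_mul] <;>
        exact Continuous.intervalIntegrable (by fun_prop) _ _
    _ ≤ s / 2 * lineEnergy G + 1 / (2 * s) * ∫ t in a..b, ‖φ t‖ ^ 2 := by gcongr
    _ = _ := by field_simp

/-- The `L²` version of the Cauchy estimate, by duality: testing `G` against the conjugate `φ` of its
`n`-th derivative on `[a, b]` gives an entire function `A z = ∫ G (t + z) φ t` with
`A⁽ⁿ⁾ 0 = ∫ ‖G⁽ⁿ⁾‖²`, which is bounded on the real line in terms of `lineEnergy G`. -/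
theorem IsBernsteinEntire.intervalIntegral_sq_iteratedDeriv_le {T : ℝ} (hT : 0 ≤ T) {G : ℂ → ℂ}
    (hG : IsBernsteinEntire T G) (n : ℕ) {ρ : ℝ} (hρ : 0 < ρ) {a b : ℝ} (hab : a ≤ b) :
    ∫ t in a..b, ‖iteratedDeriv n G t‖ ^ 2 ≤
      (n.factorial * Real.exp (T * ρ) / ρ ^ n) ^ 2 * lineEnergy G := by
  set c : ℝ := n.factorial * Real.exp (T * ρ) / ρ ^ n with hc
  have hcpos : 0 < c := by positivity
  have hcont := (hG.differentiable.complex_iteratedDeriv n).continuous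
  have hcG := hG.differentiable.continuous
  set φ : ℝ → ℂ := fun t => (starRingEnd ℂ) (iteratedDeriv n G t) with hφd
  have hφ : Continuous φ := by fun_prop
  set S : ℝ := ∫ t in a..b, ‖φ t‖ ^ 2 with hS
  have hSφ : ∫ t in a..b, ‖iteratedDeriv n G t‖ ^ 2 = S := by simp [hS, hφd]
  set A : ℂ → ℂ := fun w => ∫ t in a..b, G (t + w) * φ t with hA
  have hAd : Differentiable ℂ A := fun z =>
    (hasDerivAt_intervalIntegral_translate hG.differentiable hφ a b z).differentiableAt
  obtain ⟨C, hC⟩ := hG.growth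
  have hAgrowth : ∀ z : ℂ, ‖A z‖ ≤ (C * ∫ t in a..b, ‖φ t‖) * Real.exp (T * |z.im|) := by
    intro z
    calc ‖A z‖ ≤ ∫ t in a..b, C * Real.exp (T * |z.im|) * ‖φ t‖ := by
          refine intervalIntegral.norm_integral_le_of_norm_le hab
            (Eventually.of_forall fun t _ => ?_) (Continuous.intervalIntegrable (by fun_prop) _ _)
          rw [norm_mul]
          have := hC (t + z)
          simp only [Complex.add_im, Complex.ofReal_im, zero_add] at this
          gcongr
      _ = _ := by rw [intervalIntegral.integral_const_mul]; ring
  -- The weight `s = c` balances the Young inequality: the result is `S ≤ (c² * lineEnergy G + S) / 2`.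
  have h := norm_iteratedDeriv_zero_le hT hρ hAd hAgrowth
    (fun x => hG.norm_intervalIntegral_translate_le hφ hab hcpos x) n
  rw [hA, iteratedDeriv_intervalIntegral_translate hφ a b n hG.differentiable] at h
  have h2 : (∫ t in a..b, iteratedDeriv n G (t + 0) * φ t) = (S : ℂ) := by
    rw [hS, ← intervalIntegral.integral_ofReal]
    congr 1
    ext t
    simp [hφd, Complex.mul_conj, Complex.normSq_eq_norm_sq]
  have hS0 : 0 ≤ S := intervalIntegral.integral_nonneg hab fun _ _ => by positivity
  simp only [h2, Complex.norm_real, Real.norm_of_nonneg hS0] at h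
  have e : n.factorial * ((c * lineEnergy G + S / c) / 2 * Real.exp (T * ρ)) / ρ ^ n =
      (c ^ 2 * lineEnergy G + S) / 2 := by
    have : n.factorial * ((c * lineEnergy G + S / c) / 2 * Real.exp (T * ρ)) / ρ ^ n =
      c * ((c * lineEnergy G + S / c) / 2) := by rw [hc]; ring
    rw [this]; field_simp
  rw [hSφ]
  change S ≤ n.factorial * ((c * lineEnergy G + S / c) / 2 * Real.exp (T * ρ)) / ρ ^ n at h
  rw [e] at h
  linarith

theorem IsBernsteinEntire.integrable_sq_iteratedDeriv {T : ℝ} (hT : 0 ≤ T) {G : ℂ → ℂ}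
    (hG : IsBernsteinEntire T G) (n : ℕ) :
    Integrable (fun x : ℝ => ‖iteratedDeriv n G x‖ ^ 2) := by
  have hcont := (hG.differentiable.complex_iteratedDeriv n).continuous
  refine integrable_of_intervalIntegral_norm_bounded (l := atTop) (a := fun i : ℕ => -(i : ℝ))
    (b := fun i : ℕ => (i : ℝ)) ((n.factorial * Real.exp (T * 1) / 1 ^ n) ^ 2 * lineEnergy G)
    (fun i => ?_) (tendsto_neg_atTop_atBot.comp tendsto_natCast_atTop_atTop)
    tendsto_natCast_atTop_atTop (Eventually.of_forall fun i => ?_)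
  · exact (Continuous.integrableOn_Icc (by fun_prop)).mono_set Ioc_subset_Icc_self
  · have := hG.intervalIntegral_sq_iteratedDeriv_le hT n one_pos
      (a := -(i : ℝ)) (b := i) (by linarith [i.cast_nonneg (α := ℝ)])
    simpa using this

theorem IsBernsteinEntire.lineEnergy_iteratedDeriv_le {T : ℝ} (hT : 0 ≤ T) {G : ℂ → ℂ}
    (hG : IsBernsteinEntire T G) (n : ℕ) {ρ : ℝ} (hρ : 0 < ρ) :
    lineEnergy (iteratedDeriv n G) ≤
      (n.factorial * Real.exp (T * ρ) / ρ ^ n) ^ 2 * lineEnergy G := by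
  refine le_of_tendsto (intervalIntegral_tendsto_integral (hG.integrable_sq_iteratedDeriv hT n)
    tendsto_neg_atTop_atBot tendsto_id) ?_
  filter_upwards [eventually_ge_atTop 0] with i hi
  exact hG.intervalIntegral_sq_iteratedDeriv_le hT n hρ (by simp only [id]; linarith)

theorem IsBernsteinEntire.derivative {T : ℝ} (hT : 0 ≤ T) {G : ℂ → ℂ}
    (hG : IsBernsteinEntire T G) : IsBernsteinEntire T (deriv G) where
  differentiable := hG.differentiable.complex_deriv
  growth := by
    obtain ⟨C, hC⟩ := hG.growth
    exact ⟨_, norm_deriv_le_mul_exp_abs_im hT hG.differentiable hC⟩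
  memLp := by
    rw [memLp_two_iff_integrable_sq_norm
      hG.differentiable.complex_deriv.continuous_ofReal_comp.aestronglyMeasurable]
    simpa using hG.integrable_sq_iteratedDeriv hT 1

theorem IsBernsteinEntire.iterated_derivative {T : ℝ} (hT : 0 ≤ T) {G : ℂ → ℂ}
    (hG : IsBernsteinEntire T G) (n : ℕ) : IsBernsteinEntire T (iteratedDeriv n G) := by
  induction n with
  | zero => simpa using hG
  | succ n ih => rw [iteratedDeriv_succ]; exact ih.derivative hT

/-! ### Bernstein's inequality on the real line -/

theorem IsBernsteinEntire.lineEnergy_deriv_eq {T : ℝ} (hT : 0 ≤ T) {G : ℂ → ℂ}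
    (hG : IsBernsteinEntire T G) :
    (lineEnergy (deriv G) : ℂ) =
      -∫ x : ℝ, G x * (starRingEnd ℂ) (deriv (deriv G) x) := by
  have h1 := hG.derivative hT
  have h2 := h1.derivative hT
  have hd (F : ℂ → ℂ) (hF : Differentiable ℂ F) (x : ℝ) :
      HasDerivAt (fun t : ℝ => F t) (deriv F x) x := (hF x).hasDerivAt.comp_ofReal
  have hparts := integral_mul_deriv_eq_deriv_mul_of_integrable
    (u := fun x : ℝ => G x) (u' := fun x : ℝ => deriv G x)
    (v := fun x : ℝ => (starRingEnd ℂ) (deriv G x))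
    (v' := fun x : ℝ => (starRingEnd ℂ) (deriv (deriv G) x))
    (fun x _ => hd G hG.differentiable x)
    (fun x _ => (hd _ h1.differentiable x).star)
    (hG.memLp.integrable_mul h2.memLp.star) (h1.memLp.integrable_mul h1.memLp.star)
    (hG.memLp.integrable_mul h1.memLp.star)
  rw [hparts, neg_neg, lineEnergy, ← integral_complex_ofReal]
  congr 1
  ext x
  simp [Complex.mul_conj, Complex.normSq_eq_norm_sq]

theorem IsBernsteinEntire.two_mul_lineEnergy_deriv_le {T : ℝ} (hT : 0 ≤ T) {G : ℂ → ℂ}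
    (hG : IsBernsteinEntire T G) {s : ℝ} (hs : 0 < s) :
    2 * lineEnergy (deriv G) ≤
      s * lineEnergy G + lineEnergy (deriv (deriv G)) / s := by
  have h2 := (hG.derivative hT).derivative hT
  have e := congrArg norm (hG.lineEnergy_deriv_eq hT)
  rw [norm_neg, Complex.norm_real, Real.norm_of_nonneg (lineEnergy_nonneg _)] at e
  have hle : ‖∫ x : ℝ, G x * (starRingEnd ℂ) (deriv (deriv G) x)‖ ≤
      ∫ x : ℝ, (s / 2 * ‖G x‖ ^ 2 + 1 / (2 * s) * ‖deriv (deriv G) x‖ ^ 2) := by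
    refine norm_integral_le_of_norm_le
      ((hG.integrable_sq.const_mul _).add (h2.integrable_sq.const_mul _))
      (Eventually.of_forall fun x => ?_)
    rw [norm_mul, RCLike.norm_conj]
    set p := ‖G x‖
    set q := ‖deriv (deriv G) x‖
    have : 0 ≤ (s * p - q) ^ 2 / (2 * s) := by positivity
    have e : s / 2 * p ^ 2 + 1 / (2 * s) * q ^ 2 - p * q = (s * p - q) ^ 2 / (2 * s) := by
      field_simp; ring
    linarith
  rw [integral_add (hG.integrable_sq.const_mul _) (h2.integrable_sq.const_mul _),
    integral_const_mul, integral_const_mul] at hle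
  rw [e]
  refine (mul_le_mul_of_nonneg_left hle zero_le_two).trans (le_of_eq ?_)
  unfold lineEnergy
  field_simp

/-- The squared norms of the successive derivatives form a log-convex sequence. -/
theorem IsBernsteinEntire.lineEnergy_deriv_sq_le {T : ℝ} (hT : 0 ≤ T) {G : ℂ → ℂ}
    (hG : IsBernsteinEntire T G) :
    lineEnergy (deriv G) ^ 2 ≤
      lineEnergy G * lineEnergy (deriv (deriv G)) := by
  rcases (lineEnergy_nonneg G).eq_or_lt with h0 | h0
  · have := hG.lineEnergy_iteratedDeriv_le hT 1 one_pos
    rw [← h0, iteratedDeriv_one] at this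
    have h1 : lineEnergy (deriv G) = 0 :=
      le_antisymm (by simpa using this) (lineEnergy_nonneg _)
    rw [h1, ← h0]; simp
  rcases (lineEnergy_nonneg (deriv G)).eq_or_lt with h1 | h1
  · rw [← h1]
    simpa using mul_nonneg h0.le (lineEnergy_nonneg _)
  -- The weight that optimizes the additive inequality.
  have h := hG.two_mul_lineEnergy_deriv_le hT (div_pos h1 h0)
  rw [div_mul_cancel₀ _ h0.ne', div_div_eq_mul_div] at h
  have h' : lineEnergy (deriv G) ≤
      lineEnergy (deriv (deriv G)) * lineEnergy G / lineEnergy (deriv G) := by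
    linarith
  rw [le_div_iff₀ h1] at h'
  linarith

/-- A weak form of Stirling's formula: `n! (e / n) ^ n` grows at most linearly. -/
theorem exists_factorial_mul_exp_div_pow_le :
    ∃ K : ℝ, 0 < K ∧ ∀ n : ℕ, 0 < n → n.factorial * Real.exp n / (n : ℝ) ^ n ≤ K * n := by
  refine ⟨Stirling.stirlingSeq 1 * √2,
    mul_pos (by simpa using Stirling.stirlingSeq'_pos 0) (by positivity), fun n hn => ?_⟩
  obtain ⟨m, rfl⟩ := Nat.exists_eq_succ_of_ne_zero hn.ne'
  have h := Stirling.stirlingSeq'_antitone (Nat.zero_le m)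
  simp only [Function.comp_apply] at h
  set n := m.succ
  have hn' : (1 : ℝ) ≤ n := by exact_mod_cast hn
  have h1 : (n.factorial : ℝ) * Real.exp n / (n : ℝ) ^ n =
      Stirling.stirlingSeq n * √(2 * n) := by
    rw [Stirling.stirlingSeq, div_pow, ← Real.exp_nat_mul, mul_one]
    have : √(2 * (n : ℝ)) ≠ 0 := by positivity
    field_simp
  rw [h1, Real.sqrt_mul zero_le_two, mul_assoc]
  have h2 : √(n : ℝ) ≤ n := Real.sqrt_le_self_iff.2 (by right; exact hn')
  have h3 : (0 : ℝ) ≤ Stirling.stirlingSeq 1 := by simpa using (Stirling.stirlingSeq'_pos 0).le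
  gcongr

theorem le_of_forall_pow_le_sq_mul_pow {q t K : ℝ} (ht : 0 < t)
    (h : ∀ n : ℕ, 0 < n → q ^ n ≤ (K * n) ^ 2 * t ^ n) : q ≤ t := by
  by_contra! hlt
  have h1 : 1 < q / t := (one_lt_div ht).2 hlt
  have h2 := tendsto_pow_const_div_const_pow_of_one_lt 2 h1
  have h3 : Tendsto (fun n : ℕ => K ^ 2 * ((n : ℝ) ^ 2 / (q / t) ^ n)) atTop (𝓝 (K ^ 2 * 0)) :=
    h2.const_mul _
  rw [mul_zero] at h3
  obtain ⟨n, hn, hn0⟩ := ((h3.eventually (gt_mem_nhds one_pos)).and (eventually_gt_atTop 0)).exists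
  have h4 := h n hn0
  have hq' : 0 < q ^ n := pow_pos (ht.trans hlt) n
  rw [div_pow, div_div_eq_mul_div, ← mul_div_assoc, div_lt_one hq'] at hn
  nlinarith

/-- Bernstein's inequality in `L²(ℝ)`, squared. By log-convexity the ratio `q` of the first two terms
bounds all later ratios from below, so `q ^ n * lineEnergy G` is at most the energy of the `n`-th
derivative, which the Cauchy estimate bounds by `(K n)² T ^ (2 n) * lineEnergy G`. -/
theorem IsBernsteinEntire.lineEnergy_deriv_le {T : ℝ} (hT : 0 < T) {G : ℂ → ℂ}
    (hG : IsBernsteinEntire T G) : lineEnergy (deriv G) ≤ T ^ 2 * lineEnergy G := by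
  have hupper := fun n ρ (hρ : (0 : ℝ) < ρ) => hG.lineEnergy_iteratedDeriv_le hT.le n hρ
  have hconv (n : ℕ) : lineEnergy (iteratedDeriv (n + 1) G) ^ 2 ≤
      lineEnergy (iteratedDeriv n G) * lineEnergy (iteratedDeriv (n + 2) G) := by
    rw [iteratedDeriv_succ (n := n + 1), iteratedDeriv_succ (n := n)]
    exact (hG.iterated_derivative hT.le n).lineEnergy_deriv_sq_le hT.le
  rcases (lineEnergy_nonneg G).eq_or_lt with h0 | h0
  · have := hupper 1 1 one_pos
    rw [iteratedDeriv_one, ← h0, mul_zero] at this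
    simpa [← h0] using this
  rcases (lineEnergy_nonneg (deriv G)).eq_or_lt with h1 | h1
  · rw [← h1]; positivity
  set q := lineEnergy (deriv G) / lineEnergy G with hq
  have hq0 : 0 < q := div_pos h1 h0
  have hstep (n : ℕ) : 0 < lineEnergy (iteratedDeriv n G) ∧
      q * lineEnergy (iteratedDeriv n G) ≤
        lineEnergy (iteratedDeriv (n + 1) G) := by
    induction n with
    | zero =>
      simp only [iteratedDeriv_zero, zero_add, iteratedDeriv_one]
      exact ⟨h0, le_of_eq (by rw [hq]; field_simp)⟩
    | succ n ih =>
      obtain ⟨i1, i2⟩ := ih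
      have i3 := (mul_pos hq0 i1).trans_le i2
      refine ⟨i3, ?_⟩
      have := hconv n
      by_contra! hcon
      nlinarith [mul_lt_mul_of_pos_left hcon i1, mul_le_mul_of_nonneg_right i2 i3.le]
  have hpow (n : ℕ) : q ^ n * lineEnergy G ≤ lineEnergy (iteratedDeriv n G) := by
    induction n with
    | zero => simp
    | succ n ih =>
      refine le_trans ?_ (hstep n).2
      rw [pow_succ', mul_assoc]
      gcongr
  obtain ⟨K, hK, hKn⟩ := exists_factorial_mul_exp_div_pow_le
  have hqT : q ≤ T ^ 2 := by
    refine le_of_forall_pow_le_sq_mul_pow (K := K) (by positivity) fun n hn => ?_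
    have hn' : (0 : ℝ) < n := by exact_mod_cast hn
    -- The radius `n / T` minimizes `exp (T * ρ) / ρ ^ n`.
    have h2 := (hpow n).trans (hupper n (n / T) (by positivity))
    have h3 := le_of_mul_le_mul_right h2 h0
    refine h3.trans ?_
    have e : n.factorial * Real.exp (T * (n / T)) / (n / T) ^ n =
        n.factorial * Real.exp n / (n : ℝ) ^ n * T ^ n := by
      rw [mul_div_cancel₀ _ hT.ne', div_pow]; field_simp
    rw [e, mul_pow, ← pow_mul, ← pow_mul, mul_comm 2 n]
    gcongr
    exact hKn n hn
  rwa [hq, div_le_iff₀ h0] at hqT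

/-! ### Passage between the half-line and the real line -/

/-- The function `x ↦ x ^ (-c) * G (log x)` on the positive half-line. It turns the Mellin derivative
`Θ_c` into ordinary differentiation of `G`, and the norm of `X²_c` into that of `L²(ℝ)`. -/
def mellinPullback (c : ℝ) (G : ℂ → ℂ) (x : ℝ) : ℂ :=
  ((x ^ (-c) : ℝ) : ℂ) * G (Real.log x)

theorem mellinWeighted_mellinPullback (c : ℝ) (G : ℂ → ℂ) {x : ℝ} (hx : 0 < x) :
    mellinWeighted c (mellinPullback c G) x = ((x ^ (-(1 / 2) : ℝ) : ℝ) : ℂ) * G (Real.log x) := by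
  rw [mellinWeighted, mellinPullback, ← mul_assoc, ← Complex.ofReal_mul, ← Real.rpow_add hx]
  congr 4
  ring

theorem lintegral_Ioi_comp_log (h : ℝ → ENNReal) :
    ∫⁻ x in Ioi (0 : ℝ), ENNReal.ofReal x⁻¹ * h (Real.log x) = ∫⁻ t, h t := by
  have := lintegral_image_eq_lintegral_abs_deriv_mul (s := univ) (f := Real.exp) (f' := Real.exp)
    MeasurableSet.univ (fun x _ => (Real.hasDerivAt_exp x).hasDerivWithinAt)
    Real.exp_injective.injOn (fun x => ENNReal.ofReal x⁻¹ * h (Real.log x))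
  rw [image_univ, Real.range_exp, Measure.restrict_univ] at this
  rw [this]
  congr 1
  ext t
  rw [Real.log_exp, ← mul_assoc, ← ENNReal.ofReal_mul (abs_nonneg _), Real.abs_exp,
    mul_inv_cancel₀ (Real.exp_pos t).ne']
  simp

theorem eLpNorm_mellinWeighted_mellinPullback (c : ℝ) (G : ℂ → ℂ) :
    eLpNorm (mellinWeighted c (mellinPullback c G)) 2 (volume.restrict (Ioi 0)) =
      eLpNorm (fun t : ℝ => G t) 2 volume := by
  rw [eLpNorm_eq_lintegral_rpow_enorm_toReal two_ne_zero ENNReal.ofNat_ne_top,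
    eLpNorm_eq_lintegral_rpow_enorm_toReal two_ne_zero ENNReal.ofNat_ne_top]
  congr 1
  rw [← lintegral_Ioi_comp_log]
  refine setLIntegral_congr_fun measurableSet_Ioi fun x (hx : 0 < x) => ?_
  simp only [mellinWeighted_mellinPullback c G hx, ENNReal.toReal_ofNat]
  rw [enorm_mul, ENNReal.mul_rpow_of_nonneg _ _ zero_le_two, ← ofReal_norm,
    Complex.norm_real, Real.norm_of_nonneg (by positivity),
    ENNReal.ofReal_rpow_of_nonneg (by positivity) zero_le_two, ← Real.rpow_mul hx.le]
  norm_num [Real.rpow_neg_one]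

theorem mellinWeighted_congr {c : ℝ} {f g : ℝ → ℂ} (h : EqOn f g (Ioi 0)) :
    mellinWeighted c f =ᵐ[volume.restrict (Ioi 0)] mellinWeighted c g := by
  filter_upwards [ae_restrict_mem measurableSet_Ioi] with x hx
  rw [mellinWeighted, mellinWeighted, h hx]

theorem MemMellinX2.congr {c : ℝ} {f g : ℝ → ℂ} (hf : MemMellinX2 c f)
    (h : EqOn f g (Ioi 0)) : MemMellinX2 c g :=
  (memLp_congr_ae (mellinWeighted_congr h)).1 hf

theorem mellinX2Norm_congr {c : ℝ} {f g : ℝ → ℂ} (h : EqOn f g (Ioi 0)) :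
    mellinX2Norm c f = mellinX2Norm c g := by
  rw [mellinX2Norm, mellinX2Norm, eLpNorm_congr_ae (mellinWeighted_congr h)]

theorem memMellinX2_mellinPullback {G : ℂ → ℂ} (hG : Continuous G) (c : ℝ) :
    MemMellinX2 c (mellinPullback c G) ↔ MemLp (fun t : ℝ => G t) 2 volume := by
  have h1 : AEStronglyMeasurable (fun t : ℝ => G t) volume :=
    (hG.comp Complex.continuous_ofReal).aestronglyMeasurable
  have h2 : AEStronglyMeasurable (mellinWeighted c (mellinPullback c G))
      (volume.restrict (Ioi 0)) := by
    have := hG.measurable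
    refine Measurable.aestronglyMeasurable ?_
    unfold mellinWeighted mellinPullback
    fun_prop
  rw [MemMellinX2, MemLp, MemLp, eLpNorm_mellinWeighted_mellinPullback]
  simp [h1, h2]

theorem IsBernsteinEntire.toReal_eLpNorm {T : ℝ} {G : ℂ → ℂ} (hG : IsBernsteinEntire T G) :
    (eLpNorm (fun t : ℝ => G t) 2 volume).toReal = √(lineEnergy G) := by
  rw [hG.memLp.eLpNorm_eq_integral_rpow_norm two_ne_zero ENNReal.ofNat_ne_top,
    ENNReal.toReal_ofReal (by positivity), Real.sqrt_eq_rpow]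
  simp [lineEnergy]

theorem IsBernsteinEntire.mellinX2Norm_eq {T : ℝ} {G : ℂ → ℂ} (hG : IsBernsteinEntire T G)
    (c : ℝ) : mellinX2Norm c (mellinPullback c G) = √(lineEnergy G) := by
  rw [mellinX2Norm, eLpNorm_mellinWeighted_mellinPullback, hG.toReal_eLpNorm]

theorem hasDerivAt_mellinPullback {G : ℂ → ℂ} (hG : Differentiable ℂ G) (c : ℝ) {x : ℝ}
    (hx : 0 < x) :
    HasDerivAt (mellinPullback c G)
      (((-c * x ^ (-c - 1) : ℝ) : ℂ) * G (Real.log x) +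
        ((x ^ (-c) : ℝ) : ℂ) * (deriv G (Real.log x) * ((x⁻¹ : ℝ) : ℂ))) x := by
  have h1 := (Real.hasDerivAt_rpow_const (p := -c) (Or.inl hx.ne')).ofReal_comp
  have h2 := (Real.hasDerivAt_log hx.ne').ofReal_comp
  have h3 := (hG (Real.log x)).hasDerivAt.comp x h2
  exact h1.mul h3

theorem mellinDeriv_mellinPullback {G : ℂ → ℂ} (hG : Differentiable ℂ G) (c : ℝ) {x : ℝ}
    (hx : 0 < x) :
    mellinDeriv c (mellinPullback c G) x = mellinPullback c (deriv G) x := by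
  rw [mellinDeriv, (hasDerivAt_mellinPullback hG c hx).deriv, Real.rpow_sub_one hx.ne',
    mellinPullback, mellinPullback]
  have : (x : ℂ) ≠ 0 := by exact_mod_cast hx.ne'
  push_cast
  field_simp
  ring

theorem eqOn_mellinDeriv {c : ℝ} {f g : ℝ → ℂ} (h : EqOn f g (Ioi 0)) :
    EqOn (mellinDeriv c f) (mellinDeriv c g) (Ioi 0) := by
  intro x hx
  have : f =ᶠ[𝓝 x] g := by filter_upwards [Ioi_mem_nhds hx] with y hy using h hy
  rw [mellinDeriv, mellinDeriv, this.deriv_eq, h hx]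

theorem eqOn_mellinDerivIter {c : ℝ} {f : ℝ → ℂ} {G : ℂ → ℂ} (hG : Differentiable ℂ G)
    (h : EqOn f (mellinPullback c G) (Ioi 0)) (r : ℕ) :
    EqOn (mellinDerivIter c r f) (mellinPullback c (iteratedDeriv r G)) (Ioi 0) := by
  induction r with
  | zero => simpa [mellinDerivIter] using h
  | succ r ih =>
    intro x hx
    rw [mellinDerivIter, eqOn_mellinDeriv ih hx,
      mellinDeriv_mellinPullback (hG.complex_iteratedDeriv r) c hx, iteratedDeriv_succ]

theorem contDiffOn_mellinPullback {G : ℂ → ℂ} (hG : Differentiable ℂ G) (c : ℝ) :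
    ContDiffOn ℝ (⊤ : ℕ∞) (mellinPullback c G) (Ioi 0) := by
  intro x (hx : 0 < x)
  refine ContDiffAt.contDiffWithinAt ?_
  have h1 : ContDiffAt ℝ (⊤ : ℕ∞) (fun y : ℝ => ((y ^ (-c) : ℝ) : ℂ)) x :=
    Complex.ofRealCLM.contDiff.contDiffAt.comp x (Real.contDiffAt_rpow_const_of_ne hx.ne')
  have h2 : ContDiffAt ℝ (⊤ : ℕ∞) (fun y : ℝ => ((Real.log y : ℝ) : ℂ)) x :=
    Complex.ofRealCLM.contDiff.contDiffAt.comp x (Real.contDiffAt_log.2 hx.ne')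
  have h3 : ContDiff ℝ (⊤ : ℕ∞) G := (hG.contDiff (n := (⊤ : ℕ∞))).restrict_scalars ℝ
  exact h1.mul (h3.contDiffAt.comp x h2)

theorem IsBernsteinEntire.lineEnergy_iteratedDeriv_le_pow {T : ℝ} (hT : 0 < T) {G : ℂ → ℂ}
    (hG : IsBernsteinEntire T G) (r : ℕ) :
    √(lineEnergy (iteratedDeriv r G)) ≤ T ^ r * √(lineEnergy G) := by
  induction r with
  | zero => simp
  | succ r ih =>
    rw [iteratedDeriv_succ]
    have h := Real.sqrt_le_sqrt ((hG.iterated_derivative hT.le r).lineEnergy_deriv_le hT)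
    rw [Real.sqrt_mul (by positivity), Real.sqrt_sq hT.le] at h
    calc _ ≤ _ := h
      _ ≤ T * (T ^ r * √(lineEnergy G)) := by gcongr
      _ = _ := by ring

theorem IsBernsteinEntire.bernstein_mellin {c T : ℝ} (hT : 0 < T) {f : ℝ → ℂ} {G : ℂ → ℂ}
    (hG : IsBernsteinEntire T G) (h : EqOn f (mellinPullback c G) (Ioi 0)) :
    ContDiffOn ℝ (⊤ : ℕ∞) f (Ioi 0) ∧
      ∀ r : ℕ, MemMellinX2 c (mellinDerivIter c r f) ∧
        mellinX2Norm c (mellinDerivIter c r f) ≤ T ^ r * mellinX2Norm c f := by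
  refine ⟨(contDiffOn_mellinPullback hG.differentiable c).congr h, fun r => ?_⟩
  have hr := eqOn_mellinDerivIter hG.differentiable h r
  have hGr := hG.iterated_derivative hT.le r
  refine ⟨((memMellinX2_mellinPullback hGr.differentiable.continuous c).2 hGr.memLp).congr hr.symm,
    ?_⟩
  rw [mellinX2Norm_congr hr, mellinX2Norm_congr h, hGr.mellinX2Norm_eq, hG.mellinX2Norm_eq]
  exact hG.lineEnergy_iteratedDeriv_le_pow hT r

/-! ### Unfolding the logarithmic surface onto the plane -/

/-- The index `k` of the sheet of the logarithmic surface over which `w` lies, that is,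
`2πk ≤ Im w < 2π(k + 1)`. -/
def logSheet (w : ℂ) : ℤ := ⌊w.im / (2 * Real.pi)⌋

/-- The angle `Im w - 2πk ∈ [0, 2π)` of `w` within its sheet. -/
def sheetAngle (w : ℂ) : ℝ := w.im - 2 * Real.pi * logSheet w

/-- The function on `ℂ` obtained from the branches `g k` on the logarithmic surface by the coordinate
`w = log z`. On the lines `Im w = 2πk`, which lie over the cut, the upper boundary function `gp k`
is used. -/
def logUnfold (g : ℤ → ℂ → ℂ) (gp : ℤ → ℝ → ℂ) (w : ℂ) : ℂ :=
  if sheetAngle w = 0 then gp (logSheet w) (Real.exp w.re) else g (logSheet w) (Complex.exp w)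

theorem sheetAngle_nonneg (w : ℂ) : 0 ≤ sheetAngle w := by
  have := Int.floor_le (w.im / (2 * Real.pi))
  rw [le_div_iff₀ Real.two_pi_pos] at this
  rw [sheetAngle, logSheet]; linarith

theorem sheetAngle_lt (w : ℂ) : sheetAngle w < 2 * Real.pi := by
  have := Int.lt_floor_add_one (w.im / (2 * Real.pi))
  rw [div_lt_iff₀ Real.two_pi_pos] at this
  rw [sheetAngle, logSheet]; linarith

theorem logSheet_eq_iff {w : ℂ} {k : ℤ} :
    logSheet w = k ↔ 2 * Real.pi * k ≤ w.im ∧ w.im < 2 * Real.pi * (k + 1) := by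
  rw [logSheet, Int.floor_eq_iff, le_div_iff₀ Real.two_pi_pos, div_lt_iff₀ Real.two_pi_pos]
  constructor <;> rintro ⟨h1, h2⟩ <;> constructor <;> linarith

theorem exp_eq_exp_re_mul_exp_sub (w : ℂ) (k : ℤ) :
    Complex.exp w = (Real.exp w.re : ℂ) *
      Complex.exp (((w.im - 2 * Real.pi * k : ℝ) : ℂ) * Complex.I) := by
  rw [Complex.ofReal_exp, ← Complex.exp_add]
  conv_lhs => rw [← Complex.re_add_im w]
  rw [← Complex.exp_periodic.sub_int_mul_eq (x := (w.re : ℂ) + w.im * Complex.I) k]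
  congr 1
  push_cast
  ring

theorem exp_re_eq (w : ℂ) (k : ℤ) : (Complex.exp w).re =
    Real.exp w.re * Real.cos (w.im - 2 * Real.pi * k) := by
  rw [exp_eq_exp_re_mul_exp_sub w k, Complex.re_ofReal_mul, Complex.exp_ofReal_mul_I_re]

theorem exp_im_eq (w : ℂ) (k : ℤ) : (Complex.exp w).im =
    Real.exp w.re * Real.sin (w.im - 2 * Real.pi * k) := by
  rw [exp_eq_exp_re_mul_exp_sub w k, Complex.im_ofReal_mul, Complex.exp_ofReal_mul_I_im]

theorem exp_mem_slitOmega {w : ℂ} {k : ℤ} (h1 : 2 * Real.pi * k < w.im)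
    (h2 : w.im < 2 * Real.pi * (k + 1)) : Complex.exp w ∈ slitOmega := by
  rw [slitOmega, mem_ofPred_eq, exp_re_eq w k, exp_im_eq w k]
  rintro ⟨h3, h4⟩
  have h5 : Real.sin (w.im - 2 * Real.pi * k) = 0 := by
    simpa [(Real.exp_pos w.re).ne'] using h4
  have h6 : 0 ≤ Real.cos (w.im - 2 * Real.pi * k) := by
    by_contra! h; nlinarith [Real.exp_pos w.re]
  have h7 : w.im - 2 * Real.pi * k - Real.pi = 0 := by
    rw [← Real.sin_eq_zero_iff_of_lt_of_lt (by linarith) (by linarith), Real.sin_sub_pi, h5]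
    simp
  rw [sub_eq_zero.1 h7, Real.cos_pi] at h6
  linarith

theorem logUnfold_of_mem {g : ℤ → ℂ → ℂ} {gp : ℤ → ℝ → ℂ} {w : ℂ} {k : ℤ}
    (h1 : 2 * Real.pi * k < w.im) (h2 : w.im < 2 * Real.pi * (k + 1)) :
    logUnfold g gp w = g k (Complex.exp w) := by
  have h := logSheet_eq_iff.2 ⟨h1.le, h2⟩
  rw [logUnfold, sheetAngle, h, if_neg (by linarith)]

theorem logUnfold_of_im_eq {g : ℤ → ℂ → ℂ} {gp : ℤ → ℝ → ℂ} {w : ℂ} {k : ℤ}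
    (h1 : w.im = 2 * Real.pi * k) : logUnfold g gp w = gp k (Real.exp w.re) := by
  have h := logSheet_eq_iff.2 (⟨h1.ge, by rw [h1]; linarith [Real.pi_pos]⟩ :
    2 * Real.pi * k ≤ w.im ∧ w.im < 2 * Real.pi * (k + 1))
  rw [logUnfold, sheetAngle, h, if_pos (by linarith)]

/-- An analytic function on the logarithmic surface becomes entire in the coordinate `w = log z`. Off
the lines over the cut it is a branch composed with `exp`; near such a line it is the function
glued from two consecutive branches, composed with `exp`. -/
theorem IsLogSurfaceExtension.differentiable_logUnfold {g₀ : ℝ → ℂ} {g : ℤ → ℂ → ℂ}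
    {gp gm : ℤ → ℝ → ℂ} (h : IsLogSurfaceExtension g₀ g gp gm) :
    Differentiable ℂ (logUnfold g gp) := by
  intro w
  have hA := sheetAngle_nonneg w
  have hB := sheetAngle_lt w
  rw [sheetAngle] at hA hB
  rcases hA.eq_or_lt with hA | hA
  · obtain ⟨k, hk⟩ : ∃ k : ℤ, logSheet w = k + 1 := ⟨logSheet w - 1, by ring⟩
    rw [hk] at hA
    push_cast at hA
    set x := Real.exp w.re with hx
    have hx0 : 0 < x := Real.exp_pos _
    have hex : Complex.exp w = x := by
      rw [exp_eq_exp_re_mul_exp_sub w (k + 1), Int.cast_add, Int.cast_one, ← hA, ← hx]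
      simp
    have hball : Metric.ball (x : ℂ) x ⊆ {z : ℂ | 0 < z.re} := by
      intro z hz
      rw [mem_ball_iff_norm] at hz
      have := (abs_lt.1 ((Complex.abs_re_le_norm (z - x)).trans_lt hz)).1
      simp only [Complex.sub_re, Complex.ofReal_re] at this
      simp only [mem_ofPred_eq]; linarith
    have hgl := h.analytic_glue k x x hx0 hx0 hball x (Metric.mem_ball_self hx0)
    have hcomp : DifferentiableAt ℂ
        (fun w' => glueBranches (g k) (g (k + 1)) (gm k) (Complex.exp w')) w :=
      DifferentiableAt.comp w (by rw [hex]; exact hgl.differentiableAt)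
        Complex.differentiable_exp.differentiableAt
    refine hcomp.congr_of_eventuallyEq ?_
    have hpi := Real.pi_pos
    have e1 : ∀ᶠ w' : ℂ in 𝓝 w, w'.im < w.im + Real.pi :=
      Complex.continuous_im.continuousAt.eventually_lt continuousAt_const (by linarith)
    have e2 : ∀ᶠ w' : ℂ in 𝓝 w, w.im - Real.pi < w'.im :=
      continuousAt_const.eventually_lt Complex.continuous_im.continuousAt (by linarith)
    filter_upwards [e1, e2] with w' h1 h2
    have him := exp_im_eq w' (k + 1)
    push_cast at him
    have hexp := Real.exp_pos w'.re
    rw [glueBranches]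
    rcases lt_trichotomy w'.im (2 * Real.pi * (k + 1)) with hl | hl | hl
    · rw [logUnfold_of_mem (k := k) (by linarith) (by linarith), if_pos]
      rw [him]
      exact mul_neg_of_pos_of_neg hexp
        (Real.sin_neg_of_neg_of_neg_pi_lt (by linarith) (by linarith))
    · have him0 : (Complex.exp w').im = 0 := by rw [him, hl]; simp
      have hre : (Complex.exp w').re = Real.exp w'.re := by
        rw [exp_re_eq w' (k + 1)]; push_cast; rw [hl]; simp
      rw [logUnfold_of_im_eq (k := k + 1) (by push_cast; exact hl), if_neg (by rw [him0]; simp),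
        if_pos him0, hre, h.lower_eq_upper_succ k _ hexp]
    · have him0 : 0 < (Complex.exp w').im := by
        rw [him]
        exact mul_pos hexp (Real.sin_pos_of_pos_of_lt_pi (by linarith) (by linarith))
      rw [logUnfold_of_mem (k := k + 1) (by push_cast; linarith) (by push_cast; linarith),
        if_neg him0.not_gt, if_neg him0.ne']
  · set k := logSheet w
    have h1 : 2 * Real.pi * k < w.im := by linarith
    have h2 : w.im < 2 * Real.pi * (k + 1) := by linarith
    have hcomp : DifferentiableAt ℂ (fun w' => g k (Complex.exp w')) w :=
      DifferentiableAt.comp w (h.analytic_branch k _ (exp_mem_slitOmega h1 h2)).differentiableAt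
        Complex.differentiable_exp.differentiableAt
    refine hcomp.congr_of_eventuallyEq ?_
    have e1 : ∀ᶠ w' : ℂ in 𝓝 w, w'.im < 2 * Real.pi * (k + 1) :=
      Complex.continuous_im.continuousAt.eventually_lt continuousAt_const h2
    have e2 : ∀ᶠ w' : ℂ in 𝓝 w, 2 * Real.pi * k < w'.im :=
      continuousAt_const.eventually_lt Complex.continuous_im.continuousAt h1
    filter_upwards [e1, e2] with w' h1 h2
    exact logUnfold_of_mem h2 h1

theorem logUnfold_eq_polarValue (g : ℤ → ℂ → ℂ) (gp gm : ℤ → ℝ → ℂ) (w : ℂ) :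
    logUnfold g gp w = polarValue (g (logSheet w)) (gp (logSheet w)) (gm (logSheet w))
      (Real.exp w.re) (sheetAngle w) := by
  rw [logUnfold, polarValue, if_neg (sheetAngle_lt w).ne, sheetAngle,
    ← exp_eq_exp_re_mul_exp_sub w (logSheet w)]

/-- A function of the Mellin–Bernstein space comes from an entire function of the Bernstein class. -/
theorem MemMellinBernstein.exists_isBernsteinEntire {c T : ℝ} {f : ℝ → ℂ}
    (hf : MemMellinBernstein c T f) :
    ∃ G : ℂ → ℂ, IsBernsteinEntire T G ∧ EqOn f (mellinPullback c G) (Ioi 0) := by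
  obtain ⟨hX, g, gp, gm, hg, ⟨C, -, hC⟩, -⟩ := hf
  have hd := hg.differentiable_logUnfold
  have heq : EqOn f (mellinPullback c (logUnfold g gp)) (Ioi 0) := by
    intro x (hx : 0 < x)
    rw [mellinPullback, logUnfold_of_im_eq (k := 0) (by simp), Complex.ofReal_re, Real.exp_log hx,
      hg.upper_zero_eq x hx, ← mul_assoc, ← Complex.ofReal_mul, ← Real.rpow_add hx]
    simp
  refine ⟨logUnfold g gp, ⟨hd, ⟨C, fun w => ?_⟩, ?_⟩, heq⟩
  · rw [logUnfold_eq_polarValue g gp gm]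
    refine (hC _ _ ⟨sheetAngle_nonneg w, (sheetAngle_lt w).le⟩ _ (Real.exp_pos _)).trans
      (le_of_eq ?_)
    rw [sheetAngle]
    congr 4
    ring
  · exact (memMellinX2_mellinPullback hd.continuous c).1 (hX.congr heq)

/-! ### Entire functions as functions on the logarithmic surface -/

/-- The branch of the logarithm on the slit plane with imaginary part in `(2πk, 2π(k + 1))`, written
through the principal branch at `-z`, whose cut is then the positive half-line. -/
def logBranch (k : ℤ) (z : ℂ) : ℂ :=
  Complex.log (-z) + ((2 * k + 1) * Real.pi : ℝ) * Complex.I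

theorem logBranch_polar (k : ℤ) {r θ : ℝ} (hr : 0 < r) (h0 : 0 < θ) (h1 : θ < 2 * Real.pi) :
    logBranch k (r * Complex.exp (θ * Complex.I)) =
      Real.log r + ((2 * Real.pi * k + θ : ℝ) : ℂ) * Complex.I := by
  have h : -((r : ℂ) * Complex.exp (θ * Complex.I)) =
      Complex.exp (Real.log r + ((θ - Real.pi : ℝ) : ℂ) * Complex.I) := by
    rw [Complex.exp_add, ← Complex.ofReal_exp, Real.exp_log hr, Complex.ofReal_sub, sub_mul,
      Complex.exp_sub, Complex.exp_pi_mul_I]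
    ring
  rw [logBranch, h, Complex.log_exp (by simp; linarith) (by simp; linarith)]
  push_cast
  ring

theorem logBranch_of_im_pos (k : ℤ) {z : ℂ} (hz : 0 < z.im) :
    logBranch k z = Complex.log z + ((2 * Real.pi * k : ℝ) : ℂ) * Complex.I := by
  rw [logBranch, Complex.log, Complex.arg_neg_eq_arg_sub_pi_of_im_pos hz, Complex.log, norm_neg]
  push_cast
  ring

theorem logBranch_of_im_neg (k : ℤ) {z : ℂ} (hz : z.im < 0) :
    logBranch k z = Complex.log z + ((2 * Real.pi * (k + 1) : ℝ) : ℂ) * Complex.I := by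
  rw [logBranch, Complex.log, Complex.arg_neg_eq_arg_add_pi_of_im_neg hz, Complex.log, norm_neg]
  push_cast
  ring

theorem analyticOnNhd_logBranch (k : ℤ) : AnalyticOnNhd ℂ (logBranch k) slitOmega := by
  intro z hz
  have hm : -z ∈ Complex.slitPlane := by
    rw [Complex.mem_slitPlane_iff]
    by_contra! h
    refine hz ⟨?_, ?_⟩
    · simpa using h.1
    · simpa using h.2
  exact ((analyticAt_id.neg).clog hm).add analyticAt_const

/-- An entire function composed with the branches of the logarithm is analytic on the logarithmic
surface. In the right half-plane, two consecutive branches glue to a branch of the logarithm that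
is a shift of the principal one. -/
theorem isLogSurfaceExtension_logBranch {G : ℂ → ℂ} (hG : Differentiable ℂ G) {g₀ : ℝ → ℂ}
    (h₀ : ∀ x : ℝ, 0 < x → G (Real.log x) = g₀ x) :
    IsLogSurfaceExtension g₀ (fun k z => G (logBranch k z))
      (fun k x => G (Real.log x + ((2 * Real.pi * k : ℝ) : ℂ) * Complex.I))
      (fun k x => G (Real.log x + ((2 * Real.pi * (k + 1) : ℝ) : ℂ) * Complex.I)) := by
  have hlim (x : ℝ) (hx : 0 < x) (a b : ℂ) :
      Tendsto (fun ε : ℝ => G (Complex.log (x + ε * a) + b)) (𝓝[>] 0)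
        (𝓝 (G (Real.log x + b))) := by
    have hlog : ContinuousAt Complex.log ((x : ℂ) + ((0 : ℝ) : ℂ) * a) := by
      refine continuousAt_clog ?_
      simp [Complex.mem_slitPlane_iff, hx]
    have hc : ContinuousAt (fun ε : ℝ => G (Complex.log (x + ε * a) + b)) 0 := by
      refine hG.continuous.continuousAt.comp ?_
      refine ContinuousAt.add ?_ continuousAt_const
      exact ContinuousAt.comp (f := fun ε : ℝ => (x : ℂ) + ε * a) hlog (by fun_prop)
    have := hc.tendsto.mono_left (nhdsWithin_le_nhds (s := Ioi 0))
    rw [Complex.ofReal_log hx.le]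
    simpa using this
  refine ⟨fun k z hz => ?_, fun k x hx => ?_, fun k x hx => ?_, fun k x hx => ?_, fun x hx => ?_,
    fun k x ρ hx hρ hball => ?_⟩
  · exact (hG.analyticAt _).comp (analyticOnNhd_logBranch k z hz)
  · refine (hlim x hx Complex.I _).congr' ?_
    filter_upwards [self_mem_nhdsWithin] with ε hε
    rw [logBranch_of_im_pos]
    simpa using hε
  · refine (hlim x hx (-Complex.I) _).congr' ?_
    filter_upwards [self_mem_nhdsWithin] with ε hε
    rw [mul_neg, ← sub_eq_add_neg, logBranch_of_im_neg]
    simpa using hε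
  · simp
  · simpa using h₀ x hx
  · have hd : DifferentiableOn ℂ
        (fun z => G (Complex.log z + ((2 * Real.pi * (k + 1) : ℝ) : ℂ) * Complex.I))
        (Metric.ball (x : ℂ) ρ) := by
      intro z hz
      have hz' : 0 < z.re := hball hz
      have h1 : DifferentiableAt ℂ Complex.log z :=
        Complex.differentiableAt_log (Or.inl hz')
      exact ((hG _).comp z (h1.add_const _)).differentiableWithinAt
    refine (hd.congr fun z hz => ?_).analyticOnNhd Metric.isOpen_ball
    have hz' : 0 < z.re := hball hz
    rw [glueBranches]
    split_ifs with h1 h2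
    · rw [logBranch_of_im_neg k h1]
    · have : (z.re : ℂ) = z := Complex.ext (by simp) (by simp [h2])
      rw [Complex.ofReal_log hz'.le, this]
    · rw [logBranch_of_im_pos (k + 1) (lt_of_le_of_ne (not_lt.1 h1) (Ne.symm h2))]
      push_cast
      rfl

theorem polarValue_logBranch (G : ℂ → ℂ) (k : ℤ) {r θ : ℝ} (hr : 0 < r)
    (hθ : θ ∈ Icc (0 : ℝ) (2 * Real.pi)) :
    polarValue (fun z => G (logBranch k z))
      (fun x => G (Real.log x + ((2 * Real.pi * k : ℝ) : ℂ) * Complex.I))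
      (fun x => G (Real.log x + ((2 * Real.pi * (k + 1) : ℝ) : ℂ) * Complex.I)) r θ =
    G (Real.log r + ((2 * Real.pi * k + θ : ℝ) : ℂ) * Complex.I) := by
  rw [polarValue]
  split_ifs with h1 h2
  · rw [h1, add_zero]
  · rw [h2, mul_add, mul_one]
  · rw [logBranch_polar k hr (lt_of_le_of_ne hθ.1 (Ne.symm h1)) (lt_of_le_of_ne hθ.2 h2)]

/-- Entire functions with the exponential bound and decay like `1 / |Re z|` in horizontal strips give
elements of the Mellin–Bernstein space; the decay is used for the uniform limits at `0` and
`∞`. -/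
theorem memMellinBernstein_mellinPullback {T C : ℝ} (hT : 0 ≤ T) {G : ℂ → ℂ}
    (hG : IsBernsteinEntire T G)
    (hC : ∀ z : ℂ, ‖G z‖ ≤ C * Real.exp (T * |z.im|) / (1 + |z.re|)) (c : ℝ) :
    MemMellinBernstein c T (mellinPullback c G) := by
  refine ⟨(memMellinX2_mellinPullback hG.differentiable.continuous c).2 hG.memLp, _, _, _,
    isLogSurfaceExtension_logBranch hG.differentiable fun x hx => ?_, ?_, fun k => ?_⟩
  · rw [mellinPullback, ← mul_assoc, ← Complex.ofReal_mul, ← Real.rpow_add hx]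
    simp
  · obtain ⟨B, hB⟩ := hG.growth
    have hB0 : 0 ≤ B := by simpa using (norm_nonneg _).trans (hB 0)
    refine ⟨B + 1, by positivity, fun k θ hθ r hr => ?_⟩
    rw [polarValue_logBranch G k hr hθ]
    refine (hB _).trans ?_
    have : ((Real.log r : ℂ) + ((2 * Real.pi * k + θ : ℝ) : ℂ) * Complex.I).im =
      2 * Real.pi * k + θ := by simp
    rw [this]
    gcongr
    linarith
  · have hC0 : 0 ≤ C := by simpa using (norm_nonneg _).trans (hC 0)
    set D : ℝ := C * Real.exp (T * (|2 * Real.pi * k| + 2 * Real.pi)) with hD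
    have hbound (r : ℝ) (hr : 0 < r) (θ : ℝ) (hθ : θ ∈ Icc (0 : ℝ) (2 * Real.pi)) :
        ‖polarValue (fun z => G (logBranch k z))
          (fun x => G (Real.log x + ((2 * Real.pi * k : ℝ) : ℂ) * Complex.I))
          (fun x => G (Real.log x + ((2 * Real.pi * (k + 1) : ℝ) : ℂ) * Complex.I)) r θ‖ ≤
        D / (1 + |Real.log r|) := by
      rw [polarValue_logBranch G k hr hθ]
      refine (hC _).trans ?_
      have h1 : ((Real.log r : ℂ) + ((2 * Real.pi * k + θ : ℝ) : ℂ) * Complex.I).im =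
        2 * Real.pi * k + θ := by simp
      have h2 : ((Real.log r : ℂ) + ((2 * Real.pi * k + θ : ℝ) : ℂ) * Complex.I).re =
        Real.log r := by simp
      have h3 : |2 * Real.pi * k + θ| ≤ |2 * Real.pi * k| + 2 * Real.pi :=
        (abs_add_le _ _).trans (by rw [abs_of_nonneg hθ.1]; linarith [hθ.2])
      rw [h1, h2, hD]
      gcongr
    have hunif (l : Filter ℝ) (hl : ∀ᶠ r in l, (0 : ℝ) < r)
        (hlog : Tendsto (fun r => |Real.log r|) l atTop) :
        TendstoUniformlyOn (fun r θ : ℝ => polarValue (fun z => G (logBranch k z))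
          (fun x => G (Real.log x + ((2 * Real.pi * k : ℝ) : ℂ) * Complex.I))
          (fun x => G (Real.log x + ((2 * Real.pi * (k + 1) : ℝ) : ℂ) * Complex.I)) r θ)
          (fun _ => 0) l (Icc (0 : ℝ) (2 * Real.pi)) := by
      have h0 : Tendsto (fun r => D / (1 + |Real.log r|)) l (𝓝 0) :=
        tendsto_const_nhds.div_atTop (tendsto_atTop_add_const_left _ _ hlog)
      rw [Metric.tendstoUniformlyOn_iff]
      intro ε hε
      filter_upwards [hl, h0.eventually (gt_mem_nhds hε)] with r hr hr' θ hθ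
      rw [dist_zero_left]
      exact (hbound r hr θ hθ).trans_lt hr'
    exact ⟨hunif _ self_mem_nhdsWithin (tendsto_abs_atBot_atTop.comp Real.tendsto_log_nhdsGT_zero),
      hunif _ (eventually_gt_atTop 0) (tendsto_abs_atTop_atTop.comp Real.tendsto_log_atTop)⟩

/-! ### Sharpness -/

/-- The entire function `sin z / z`, with value `1` at `0`. -/
def entireSinc : ℂ → ℂ := dslope Complex.sin 0

theorem differentiable_entireSinc : Differentiable ℂ entireSinc := by
  rw [← differentiableOn_univ, entireSinc, Complex.differentiableOn_dslope univ_mem]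
  exact Complex.differentiable_sin.differentiableOn

theorem entireSinc_zero : entireSinc 0 = 1 := by
  simp [entireSinc]

theorem mul_entireSinc (z : ℂ) : z * entireSinc z = Complex.sin z := by
  simpa [entireSinc] using sub_smul_dslope Complex.sin 0 z

theorem norm_sin_le_exp_abs_im (z : ℂ) : ‖Complex.sin z‖ ≤ Real.exp |z.im| := by
  rw [Complex.sin, norm_div, norm_mul, Complex.norm_I, mul_one, Complex.norm_two,
    div_le_iff₀ two_pos]
  refine (norm_sub_le _ _).trans ?_
  rw [Complex.norm_exp, Complex.norm_exp]
  have h1 : Real.exp (-z * Complex.I).re ≤ Real.exp |z.im| := by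
    gcongr; simpa using le_abs_self z.im
  have h2 : Real.exp (z * Complex.I).re ≤ Real.exp |z.im| := by
    gcongr; simpa using neg_le_abs z.im
  linarith

theorem exists_norm_entireSinc_le :
    ∃ C : ℝ, 0 ≤ C ∧ ∀ z : ℂ, ‖entireSinc z‖ ≤ C * Real.exp |z.im| / (1 + |z.re|) := by
  -- On the unit disk compactness bounds the quotient; outside it `sin` does.
  obtain ⟨B, hB⟩ := (isCompact_closedBall (0 : ℂ) 1).exists_bound_of_continuousOn
    differentiable_entireSinc.continuous.continuousOn
  have hB0 : 0 ≤ B := (norm_nonneg _).trans (hB 0 (by simp))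
  refine ⟨B + 2, by positivity, fun z => ?_⟩
  have hsin := norm_sin_le_exp_abs_im z
  have hexp : 1 ≤ Real.exp |z.im| := Real.one_le_exp (abs_nonneg _)
  have hmul : ‖z‖ * ‖entireSinc z‖ = ‖Complex.sin z‖ := by rw [← norm_mul, mul_entireSinc]
  have h1 : ‖entireSinc z‖ ≤ (B + 1) * Real.exp |z.im| := by
    rcases le_total ‖z‖ 1 with h | h
    · have := hB z (by simpa using h)
      nlinarith
    · nlinarith [norm_nonneg (entireSinc z)]
  rw [le_div_iff₀ (by positivity)]
  have h2 : |z.re| * ‖entireSinc z‖ ≤ ‖z‖ * ‖entireSinc z‖ := by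
    gcongr; exact Complex.abs_re_le_norm z
  nlinarith

theorem isBernsteinEntire_of_norm_le {T C : ℝ} {G : ℂ → ℂ} (hG : Differentiable ℂ G)
    (hC : ∀ z : ℂ, ‖G z‖ ≤ C * Real.exp (T * |z.im|) / (1 + |z.re|)) : IsBernsteinEntire T G := by
  have hC0 : 0 ≤ C := by simpa using (norm_nonneg _).trans (hC 0)
  refine ⟨hG, ⟨C, fun z => (hC z).trans (div_le_self (by positivity) (by simp))⟩, ?_⟩
  rw [memLp_two_iff_integrable_sq_norm hG.continuous_ofReal_comp.aestronglyMeasurable]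
  refine (integrable_inv_one_add_sq.const_mul (C ^ 2)).mono'
    ((hG.continuous_ofReal_comp.norm.pow 2).aestronglyMeasurable)
    (Eventually.of_forall fun x => ?_)
  have h := hC x
  simp only [Complex.ofReal_im, abs_zero, mul_zero, Real.exp_zero, mul_one, Complex.ofReal_re] at h
  rw [Real.norm_of_nonneg (by positivity), ← div_eq_mul_inv]
  calc ‖G x‖ ^ 2 ≤ (C / (1 + |x|)) ^ 2 := by gcongr
    _ = C ^ 2 / (1 + |x|) ^ 2 := div_pow _ _ _
    _ ≤ C ^ 2 / (1 + x ^ 2) := by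
      gcongr
      nlinarith [sq_abs x, abs_nonneg x]

/-- The modulation `z ↦ exp (i a z) F z`, which shifts frequencies by `a` and does not change norms on
the real line. -/
def modulate (a : ℝ) (F : ℂ → ℂ) (z : ℂ) : ℂ := Complex.exp (a * z * Complex.I) * F z

theorem norm_modulate (a : ℝ) (F : ℂ → ℂ) (z : ℂ) :
    ‖modulate a F z‖ = Real.exp (-(a * z.im)) * ‖F z‖ := by
  rw [modulate, norm_mul, Complex.norm_exp]
  simp

theorem norm_modulate_ofReal (a : ℝ) (F : ℂ → ℂ) (x : ℝ) : ‖modulate a F x‖ = ‖F x‖ := by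
  simp [norm_modulate]

theorem norm_modulate_le {a : ℝ} (ha : 0 ≤ a) (F : ℂ → ℂ) (z : ℂ) :
    ‖modulate a F z‖ ≤ Real.exp (a * |z.im|) * ‖F z‖ := by
  rw [norm_modulate]
  gcongr
  nlinarith [neg_le_abs z.im]

theorem lineEnergy_modulate (a : ℝ) (F : ℂ → ℂ) : lineEnergy (modulate a F) = lineEnergy F := by
  simp [lineEnergy, norm_modulate_ofReal]

theorem differentiable_modulate (a : ℝ) {F : ℂ → ℂ} (hF : Differentiable ℂ F) :
    Differentiable ℂ (modulate a F) := by
  unfold modulate; fun_prop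

theorem IsBernsteinEntire.modulation {a b : ℝ} (ha : 0 ≤ a) {F : ℂ → ℂ}
    (hF : IsBernsteinEntire b F) : IsBernsteinEntire (a + b) (modulate a F) where
  differentiable := differentiable_modulate a hF.differentiable
  growth := by
    obtain ⟨C, hC⟩ := hF.growth
    refine ⟨C, fun z => (norm_modulate_le ha F z).trans ?_⟩
    calc _ ≤ Real.exp (a * |z.im|) * (C * Real.exp (b * |z.im|)) := by gcongr; exact hC z
      _ = _ := by rw [add_mul, Real.exp_add]; ring
  memLp := by
    refine (memLp_congr_norm
      (differentiable_modulate a hF.differentiable).continuous_ofReal_comp.aestronglyMeasurable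
      hF.differentiable.continuous_ofReal_comp.aestronglyMeasurable
      (Eventually.of_forall fun x => norm_modulate_ofReal a F x)).2 hF.memLp

theorem deriv_modulate (a : ℝ) {F : ℂ → ℂ} (hF : Differentiable ℂ F) :
    deriv (modulate a F) =
      fun z => (a * Complex.I) * modulate a F z + modulate a (deriv F) z := by
  ext z
  have h1 : HasDerivAt (fun z : ℂ => Complex.exp (a * z * Complex.I))
      (Complex.exp (a * z * Complex.I) * (a * 1 * Complex.I)) z :=
    (((hasDerivAt_id z).const_mul (a : ℂ)).mul_const Complex.I).cexp
  have h := (h1.mul (hF z).hasDerivAt).deriv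
  change deriv (modulate a F) z = _ at h
  rw [h]
  simp only [modulate]
  ring

theorem iteratedDeriv_succ_modulate (a : ℝ) {F : ℂ → ℂ} (hF : Differentiable ℂ F) (r : ℕ) (z : ℂ) :
    iteratedDeriv (r + 1) (modulate a F) z =
      (a * Complex.I) * iteratedDeriv r (modulate a F) z +
        iteratedDeriv r (modulate a (deriv F)) z := by
  have h1 : ContDiffAt ℂ r (modulate a F) z := (differentiable_modulate a hF).contDiff.contDiffAt
  have h2 : ContDiffAt ℂ r (modulate a (deriv F)) z :=
    (differentiable_modulate a hF.complex_deriv).contDiff.contDiffAt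
  rw [iteratedDeriv_succ', deriv_modulate a hF, iteratedDeriv_fun_add (contDiffAt_const.mul h1) h2,
    iteratedDeriv_const_mul_field]

/-- One step towards the lower bound: since `(exp (i a z) F)' = i a exp (i a z) F + exp (i a z) F'`,
where Bernstein's inequality makes the last term small with `b`, each differentiation of
`modulate a F` multiplies the norm by at least `a`, up to a small error. -/
theorem IsBernsteinEntire.mul_sqrt_lineEnergy_le {a b : ℝ} (ha : 0 ≤ a) (hb : 0 < b) {F : ℂ → ℂ}
    (hF : IsBernsteinEntire b F) (r : ℕ) :
    a * √(lineEnergy (iteratedDeriv r (modulate a F))) ≤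
      √(lineEnergy (iteratedDeriv (r + 1) (modulate a F))) +
        (a + b) ^ r * b * √(lineEnergy F) := by
  have hab : 0 < a + b := by linarith
  have hE := (hF.derivative hb.le).modulation ha
  have h0 := (hF.modulation ha).iterated_derivative hab.le r
  have h1 := (hF.modulation ha).iterated_derivative hab.le (r + 1)
  have h2 := hE.iterated_derivative hab.le r
  have htri : √(lineEnergy (fun z => (a * Complex.I) * iteratedDeriv r (modulate a F) z)) ≤
      √(lineEnergy (iteratedDeriv (r + 1) (modulate a F))) +
        √(lineEnergy (iteratedDeriv r (modulate a (deriv F)))) := by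
    have hE' : IsBernsteinEntire (a + b)
        (fun z => (a * Complex.I) * iteratedDeriv r (modulate a F) z) := by
      refine ⟨h0.differentiable.const_mul _, ?_, h0.memLp.const_mul _⟩
      obtain ⟨C, hC⟩ := h0.growth
      refine ⟨‖(a : ℂ) * Complex.I‖ * C, fun z => ?_⟩
      rw [norm_mul, mul_assoc]
      gcongr
      exact hC z
    rw [← hE'.toReal_eLpNorm, ← h1.toReal_eLpNorm, ← h2.toReal_eLpNorm,
      ← ENNReal.toReal_add h1.memLp.eLpNorm_ne_top h2.memLp.eLpNorm_ne_top]
    refine ENNReal.toReal_mono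
      (ENNReal.add_ne_top.2 ⟨h1.memLp.eLpNorm_ne_top, h2.memLp.eLpNorm_ne_top⟩) ?_
    refine le_trans (le_of_eq ?_) (eLpNorm_sub_le h1.memLp.1 h2.memLp.1 one_le_two)
    congr 1
    ext x
    simp [iteratedDeriv_succ_modulate a hF.differentiable]
  have hscale : √(lineEnergy (fun z => (a * Complex.I) * iteratedDeriv r (modulate a F) z)) =
      a * √(lineEnergy (iteratedDeriv r (modulate a F))) := by
    simp only [lineEnergy, norm_mul, Complex.norm_I, mul_one, Complex.norm_real, mul_pow,
      Real.norm_of_nonneg ha, integral_const_mul]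
    rw [Real.sqrt_mul (by positivity), Real.sqrt_sq ha]
  have h3 := hE.lineEnergy_iteratedDeriv_le_pow hab r
  rw [lineEnergy_modulate] at h3
  have h4 := hF.lineEnergy_iteratedDeriv_le_pow hb 1
  rw [iteratedDeriv_one, pow_one] at h4
  rw [hscale] at htri
  calc _ ≤ _ := htri
    _ ≤ √(lineEnergy (iteratedDeriv (r + 1) (modulate a F))) +
        (a + b) ^ r * (b * √(lineEnergy F)) := by
      gcongr
      refine h3.trans ?_
      gcongr
    _ = _ := by ring

theorem IsBernsteinEntire.le_sqrt_lineEnergy_iteratedDeriv_modulate {a b : ℝ} (ha : 0 ≤ a)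
    (hb : 0 < b) {F : ℂ → ℂ} (hF : IsBernsteinEntire b F) (r : ℕ) :
    ((a + b) * a ^ r - r * (a + b) ^ r * b) * √(lineEnergy F) ≤
      (a + b) * √(lineEnergy (iteratedDeriv r (modulate a F))) := by
  have hab : 0 < a + b := by linarith
  induction r with
  | zero => simp [lineEnergy_modulate]
  | succ r ih =>
    have h1 := mul_le_mul_of_nonneg_left (hF.mul_sqrt_lineEnergy_le ha hb r) hab.le
    have h2 := mul_le_mul_of_nonneg_left ih ha
    have h3 : 0 ≤ r * (a + b) ^ r * b * b * √(lineEnergy F) := by positivity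
    push_cast
    have e : ((a + b) * a ^ (r + 1) - (r + 1) * (a + b) ^ (r + 1) * b) * √(lineEnergy F) =
      a * (((a + b) * a ^ r - r * (a + b) ^ r * b) * √(lineEnergy F)) -
        (a + b) * ((a + b) ^ r * b * √(lineEnergy F)) -
        r * (a + b) ^ r * b * b * √(lineEnergy F) := by ring
    rw [e]
    linarith

theorem lineEnergy_pos {G : ℂ → ℂ} (hG : Continuous G) (h0 : G 0 ≠ 0)
    (hi : Integrable (fun x : ℝ => ‖G x‖ ^ 2)) : 0 < lineEnergy G := by
  have hc : Continuous (fun x : ℝ => ‖G x‖ ^ 2) :=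
    ((hG.comp Complex.continuous_ofReal).norm).pow 2
  rw [lineEnergy, integral_pos_iff_support_of_nonneg (fun _ => by positivity) hi]
  exact hc.isOpen_support.measure_pos _ ⟨0, by simpa using h0⟩

/-- For small `b`, the frequencies of `exp (i (T - b) z) sinc (b z)` lie in `[T - 2 b, T]`, near the
largest one allowed. -/
theorem exists_extremal {T b : ℝ} (hb : 0 < b) (hbT : b ≤ T) (hb1 : b ≤ 1) :
    ∃ F : ℂ → ℂ, IsBernsteinEntire b F ∧ 0 < lineEnergy F ∧
      ∀ c : ℝ, MemMellinBernstein c T (mellinPullback c (modulate (T - b) F)) := by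
  obtain ⟨C, hC0, hC⟩ := exists_norm_entireSinc_le
  have hbound (z : ℂ) : ‖entireSinc (b * z)‖ ≤
      (C / b) * Real.exp (b * |z.im|) / (1 + |z.re|) := by
    have h := hC (b * z)
    rw [Complex.im_ofReal_mul, Complex.re_ofReal_mul, abs_mul, abs_mul, abs_of_pos hb] at h
    calc _ ≤ _ := h
      -- `b (1 + |x|) ≤ 1 + b |x|`, as `b ≤ 1`.
      _ ≤ C * Real.exp (b * |z.im|) / (b * (1 + |z.re|)) := by
        gcongr
        linarith
      _ = _ := by field_simp
  have hd : Differentiable ℂ fun z : ℂ => entireSinc (b * z) := by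
    have := differentiable_entireSinc
    fun_prop
  have hF := isBernsteinEntire_of_norm_le hd hbound
  have ha : 0 ≤ T - b := by linarith
  refine ⟨fun z => entireSinc (b * z), hF,
    lineEnergy_pos hd.continuous (by simp [entireSinc_zero]) hF.integrable_sq, fun c => ?_⟩
  refine memMellinBernstein_mellinPullback (C := C / b) (by linarith)
    (by simpa using hF.modulation ha) (fun z => ?_) c
  refine (norm_modulate_le ha _ z).trans ?_
  calc _ ≤ Real.exp ((T - b) * |z.im|) * ((C / b) * Real.exp (b * |z.im|) / (1 + |z.re|)) := by
        gcongr; exact hbound z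
    _ = C / b * (Real.exp ((T - b) * |z.im|) * Real.exp (b * |z.im|)) / (1 + |z.re|) := by ring
    _ = _ := by rw [← Real.exp_add]; congr 3; ring

theorem pow_le_of_forall_mellinX2Norm_le {c T : ℝ} (hT : 0 < T) {r : ℕ} {K : ℝ}
    (hK : ∀ f : ℝ → ℂ, MemMellinBernstein c T f →
      mellinX2Norm c (mellinDerivIter c r f) ≤ K * mellinX2Norm c f) : T ^ r ≤ K := by
  -- Test the inequality with the near-extremal functions and let `b → 0`.
  have key : ∀ b : ℝ, 0 < b → b ≤ min T 1 → T * (T - b) ^ r - r * T ^ r * b ≤ T * K := by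
    intro b hb hbT
    obtain ⟨F, hF, hpos, hmem⟩ := exists_extremal hb (hbT.trans (min_le_left _ _))
      (hbT.trans (min_le_right _ _))
    have ha : 0 ≤ T - b := by linarith [hbT.trans (min_le_left _ _)]
    have hG : IsBernsteinEntire T (modulate (T - b) F) := by simpa using hF.modulation ha
    have h1 := hK _ (hmem c)
    rw [mellinX2Norm_congr (eqOn_mellinDerivIter hG.differentiable (fun _ _ => rfl) r),
      (hG.iterated_derivative hT.le r).mellinX2Norm_eq, hG.mellinX2Norm_eq,
      lineEnergy_modulate] at h1
    have h2 := hF.le_sqrt_lineEnergy_iteratedDeriv_modulate ha hb r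
    rw [sub_add_cancel] at h2
    refine le_of_mul_le_mul_right ?_ (Real.sqrt_pos.2 hpos)
    calc _ ≤ _ := h2
      _ ≤ T * (K * √(lineEnergy F)) := by gcongr
      _ = _ := by ring
  have hlim : Tendsto (fun b : ℝ => T * (T - b) ^ r - r * T ^ r * b) (𝓝[>] 0) (𝓝 (T * T ^ r)) := by
    have hc : Continuous (fun b : ℝ => T * (T - b) ^ r - r * T ^ r * b) := by fun_prop
    simpa using (hc.tendsto 0).mono_left (nhdsWithin_le_nhds (s := Ioi 0))
  refine le_of_mul_le_mul_left (le_of_tendsto hlim ?_) hT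
  filter_upwards [Ioc_mem_nhdsGT (lt_min hT one_pos)] with b hb using key b hb.1 hb.2

end

theorem theorem5 (c T : ℝ) (hT : 0 < T) :
    (∀ f : ℝ → ℂ, MemMellinBernstein c T f →
      ContDiffOn ℝ (⊤ : ℕ∞) f (Set.Ioi (0 : ℝ)) ∧
      ∀ r : ℕ, MemMellinX2 c (mellinDerivIter c r f) ∧
        mellinX2Norm c (mellinDerivIter c r f) ≤ T ^ r * mellinX2Norm c f) ∧
    (∀ (r : ℕ) (K : ℝ),
      (∀ f : ℝ → ℂ, MemMellinBernstein c T f →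
        mellinX2Norm c (mellinDerivIter c r f) ≤ K * mellinX2Norm c f) →
      T ^ r ≤ K) := by
  refine ⟨fun f hf => ?_, fun r K hK => pow_le_of_forall_mellinX2Norm_le hT hK⟩
  obtain ⟨G, hG, h⟩ := hf.exists_isBernsteinEntire
  exact hG.bernstein_mellin hT h
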